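/- Consider deterministic Turing machines with a read-only input tape over $\{0,1\}$ delimited by end markers and a finite number of two-way infinite work tapes. Let $\mathrm{P}$ be the class of languages $A\subseteq\{0,1\}^*$ decided by such a machine in a number of steps bounded by a polynomial in the input length, and let $\mathrm{L}$ be the class of languages decided by such a machine that, for some constant $c$, visits at most $c\,(\lfloor\log_2 m\rfloor+1)$ work-tape cells on every input of length $m\ge 1$ (and at most $c$ cells on the empty input). A garden-hose game with $s$ pipes for inputs $x,y\in\{0,1\}^n$ consists of the vertex sets $A_\circ=\{0,1^A,\dots,s^A\}$ (with the tap $0$) and $B=\{1^B,\dots,s^B\}$, and of functions $x\mapsto E_{A_\circ}(x)$ and $y\mapsto E_B(y)$ whose values are loop-free edge sets on $A_\circ$ and on $B$, respectively, of maximum degree at most $1$. Let $G(x,y)$ be the graph on $A_\circ\cup B$ with edge set $\{\{i^A,i^B\}:1\le i\le s\}\cup E_{A_\circ}(x)\cup E_B(y)$. The game computes $g:\{0,1\}^n\times\{0,1\}^n\to\{0,1\}$ if for all $x,y$ the unique maximal path of $G(x,y)$ starting at $0$ ends in $A_\circ$ when $g(x,y)=0$ and in $B$ when $g(x,y)=1$.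 The garden-hose complexity $GH(g)$ is the least number of pipes of a garden-hose game that computes $g$. Let $f=(f_n)_{n\ge 0}$ with $f_n:\{0,1\}^n\times\{0,1\}^n\to\{0,1\}$ be a family of functions such that (i) $f$ is in $\mathrm{P}$, that is, the language $\{xy : n\ge 0,\ x,y\in\{0,1\}^n,\ f_n(x,y)=1\}$ is in $\mathrm{P}$, and (ii) $f$ has superpolynomial garden-hose complexity, that is, there is no polynomial $p$ with $GH(f_n)\le p(n)$ for all $n$. If such a family $f$ exists, then $\mathrm{P}\ne \mathrm{L}$. -/

import Mathlib

namespace GardenHose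

/-! ### Turing machines with a read-only input tape and several work tapes -/

/-- What the input head sees: an end marker or an input bit. -/
inductive InSymbol where
  | leftEnd
  | bit (b : Bool)
  | rightEnd

/-- A head move. -/
inductive Move where
  | left
  | stay
  | right

/-- A deterministic Turing machine with a read-only input tape over `{0,1}` delimited by end
markers, and `k` read-write work tapes, infinite in both directions. A state `q` with
`halt q = some b` is a halting state with output `b`. In the other states, given the state, the
symbol under the input head and the symbols under the work heads, `δ` returns the next state, the
move of the input head, and for each work tape the symbol to write and the move of its head. -/
structure TM where
  k : ℕ
  State : Type
  Γ : Type
  [finState : Finite State]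
  [finΓ : Finite Γ]
  blank : Γ
  start : State
  halt : State → Option Bool
  δ : State → InSymbol → (Fin k → Γ) → State × Move × (Fin k → Γ × Move)

namespace TM

/-- The configurations of a machine; the input word is kept apart. -/
structure Cfg (M : TM) where
  state : M.State
  inPos : ℕ
  head : Fin M.k → ℤ
  tape : Fin M.k → ℤ → M.Γ

/-- The cells of the input tape: `0` holds the left end marker, `1, …, |w|` hold the word `w`, and
`|w| + 1` holds the right end marker. -/
def readInput (w : List Bool) : ℕ → InSymbol
  | 0 => .leftEnd
  | i + 1 => match w[i]? with
    | some b => .bit b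
    | none => .rightEnd

/-- The input head stays within the cells `0, …, n + 1`. -/
def moveInput (n : ℕ) : Move → ℕ → ℕ
  | .left, i => i - 1
  | .stay, i => i
  | .right, i => min (i + 1) (n + 1)

def moveWork : Move → ℤ → ℤ
  | .left, i => i - 1
  | .stay, i => i
  | .right, i => i + 1

variable (M : TM)

/-- The input head starts on the left end marker, the work tapes are blank. -/
def init : M.Cfg where
  state := M.start
  inPos := 0
  head := fun _ => 0
  tape := fun _ _ => M.blank

/-- One step on the input word `w`; a halted configuration does not change any more. -/
def step (w : List Bool) (c : M.Cfg) : M.Cfg :=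
  match M.halt c.state with
  | some _ => c
  | none =>
    let r := M.δ c.state (readInput w c.inPos) (fun i => c.tape i (c.head i))
    { state := r.1
      inPos := moveInput w.length r.2.1 c.inPos
      head := fun i => moveWork (r.2.2 i).2 (c.head i)
      tape := fun i => Function.update (c.tape i) (c.head i) (r.2.2 i).1 }

/-- The configuration after `t` steps on the input word `w`. -/
def run (w : List Bool) (t : ℕ) : M.Cfg := (M.step w)^[t] M.init

/-- After at most `t` steps on input `w`, the machine has halted with the correct answer to the
question whether `w ∈ A`. -/
def DecidesWithin (A : Language Bool) (w : List Bool) (t : ℕ) : Prop :=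
  ∃ b : Bool, M.halt (M.run w t).state = some b ∧ (b = true ↔ w ∈ A)

/-- The work tape cells (tape number and position) that are ever visited on the input word `w`. -/
def visited (w : List Bool) : Set (Fin M.k × ℤ) :=
  {c | ∃ t, (M.run w t).head c.1 = c.2}

end TM

/-- The class P: languages decided by a deterministic Turing machine in polynomial time. -/
def classP : Set (Language Bool) :=
  {A | ∃ (M : TM) (p : Polynomial ℕ), ∀ w, M.DecidesWithin A w (p.eval w.length)}

/-- The class L: languages decided by a deterministic Turing machine (halting on all inputs) that
visits `O(log n)` work tape cells on inputs of length `n`. The bound `c * (⌊log₂ n⌋ + 1)` rather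
than `c * log n` takes care of the lengths `n = 0, 1`. -/
def classL : Set (Language Bool) :=
  {A | ∃ (M : TM) (c : ℕ), ∀ w, (∃ t, M.DecidesWithin A w t) ∧
    (M.visited w).encard ≤ ((c * (Nat.log 2 w.length + 1) : ℕ) : ℕ∞)}

/-! ### The garden-hose game -/

/-- Maximum degree at most one: every vertex has at most one neighbour. -/
def MaxDegLeOne {V : Type*} (H : SimpleGraph V) : Prop :=
  ∀ u v w, H.Adj u v → H.Adj u w → v = w

/-- A garden-hose game with inputs in `{0,1}ⁿ × {0,1}ⁿ` and `s` pipes. Alice's vertices are the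
water tap `none` and her ends `some i` of the pipes, Bob's vertices are his ends `i` of the pipes.
`EA x` and `EB y` are the connections the players make depending on their own input. -/
structure Game (n s : ℕ) where
  EA : (Fin n → Bool) → SimpleGraph (Option (Fin s))
  EB : (Fin n → Bool) → SimpleGraph (Fin s)
  degA : ∀ x, MaxDegLeOne (EA x)
  degB : ∀ y, MaxDegLeOne (EB y)

/-- The adjacency relation of the graph consisting of the pipes and of both players' connections. -/
def joinAdj {s : ℕ} (HA : SimpleGraph (Option (Fin s))) (HB : SimpleGraph (Fin s)) :
    Option (Fin s) ⊕ Fin s → Option (Fin s) ⊕ Fin s → Prop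
  | .inl a, .inl b => HA.Adj a b
  | .inr a, .inr b => HB.Adj a b
  | .inl a, .inr j => a = some j
  | .inr j, .inl a => a = some j

namespace Game

variable {n s : ℕ}

/-- The graph `G(x, y)`. -/
def graph (G : Game n s) (x y : Fin n → Bool) : SimpleGraph (Option (Fin s) ⊕ Fin s) where
  Adj := joinAdj (G.EA x) (G.EB y)
  symm := ⟨by
    rintro (a | a) (b | b) h
    · exact (G.EA x).adj_symm h
    · exact h
    · exact h
    · exact (G.EB y).adj_symm h⟩
  loopless := ⟨by
    rintro (a | a) h
    · exact (G.EA x).irrefl h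
    · exact (G.EB y).irrefl h⟩

/-- The vertex of the water tap. -/
def tap : Option (Fin s) ⊕ Fin s := .inl none

end Game

/-- A path that cannot be prolonged at its end. -/
def IsMaximalPath {V : Type*} {H : SimpleGraph V} {u v : V} (p : H.Walk u v) : Prop :=
  p.IsPath ∧ ∀ w, H.Adj v w → w ∈ p.support

/-- The game computes `f`: for all inputs, the maximal path that starts at the tap (there is exactly
one, as the tap has degree at most one and all the other vertices have degree at most two) ends on
Alice's side if `f x y = 0` and on Bob's side if `f x y = 1`. -/
def Game.Computes {n s : ℕ} (G : Game n s) (f : (Fin n → Bool) → (Fin n → Bool) → Bool) : Prop :=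
  ∀ x y, ∃ (v : Option (Fin s) ⊕ Fin s) (p : (G.graph x y).Walk Game.tap v),
    IsMaximalPath p ∧ (f x y = false → v.isLeft = true) ∧ (f x y = true → v.isRight = true)

/-- Every Boolean function is computed by some garden-hose game. -/
theorem exists_computes {n : ℕ} (f : (Fin n → Bool) → (Fin n → Bool) → Bool) :
    ∃ s, ∃ G : Game n s, G.Computes f := by
  classical
  let e := Fintype.equivFin ((Fin n → Bool) × Bool)
  let G : Game n (Fintype.card ((Fin n → Bool) × Bool)) :=
    { EA := fun x => SimpleGraph.edge none (some (e (x, false)))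
      EB := fun y => SimpleGraph.fromRel fun i j =>
        ∃ x, f x y = false ∧ i = e (x, false) ∧ j = e (x, true)
      degA := by
        intro x u v w hv hw
        simp only [SimpleGraph.edge_adj] at hv hw
        grind
      degB := by
        intro y u v w hv hw
        simp only [SimpleGraph.fromRel_adj] at hv hw
        grind [e.injective.eq_iff] }
  refine ⟨_, G, fun x y => ?_⟩
  have h1 : (G.graph x y).Adj Game.tap (.inl (some (e (x, false)))) := by
    change (G.EA x).Adj _ _
    simp [G, SimpleGraph.edge_adj]
  have h2 : (G.graph x y).Adj (.inl (some (e (x, false)))) (.inr (e (x, false))) := rfl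
  cases hf : f x y with
  | true =>
    refine ⟨_, .cons h1 (.cons h2 .nil), ⟨?_, ?_⟩, by simp, by simp⟩
    · rw [SimpleGraph.Walk.isPath_def]
      change List.Nodup [Game.tap, .inl (some (e (x, false))), .inr (e (x, false))]
      simp [Game.tap]
    · rintro (a | a) h
      · change a = _ at h
        simp [h]
      · change (G.EB y).Adj _ _ at h
        simp only [G, SimpleGraph.fromRel_adj] at h
        grind [e.injective.eq_iff]
  | false =>
    have h3 : (G.graph x y).Adj (.inr (e (x, false))) (.inr (e (x, true))) := by
      change (G.EB y).Adj _ _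
      simp [G, SimpleGraph.fromRel_adj, hf]
    have h4 : (G.graph x y).Adj (.inr (e (x, true))) (.inl (some (e (x, true)))) := rfl
    refine ⟨_, .cons h1 (.cons h2 (.cons h3 (.cons h4 .nil))), ⟨?_, ?_⟩, by simp, by simp⟩
    · rw [SimpleGraph.Walk.isPath_def]
      change List.Nodup [Game.tap, .inl (some (e (x, false))), .inr (e (x, false)),
        .inr (e (x, true)), .inl (some (e (x, true)))]
      simp [Game.tap]
    · rintro (a | a) h
      · change (G.EA x).Adj _ _ at h
        simp [G, SimpleGraph.edge_adj] at h
      · change some _ = some a at h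
        simp at h
        simp [← h]

/-- The garden-hose complexity of `f`: the least number of pipes of a game that computes `f`. -/
noncomputable def gh {n : ℕ} (f : (Fin n → Bool) → (Fin n → Bool) → Bool) : ℕ :=
  sInf {s | ∃ G : Game n s, G.Computes f}

/-! ### Families of Boolean functions -/

/-- A function `f : {0,1}ⁿ × {0,1}ⁿ → {0,1}` for every `n`. -/
def BoolFamily : Type := ∀ n : ℕ, (Fin n → Bool) → (Fin n → Bool) → Bool

/-- The decision problem of `f`: the words `xy` with `|x| = |y|` and `f(x, y) = 1`. -/
def BoolFamily.language (f : BoolFamily) : Language Bool :=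
  {w | ∃ (n : ℕ) (x y : Fin n → Bool), w = List.ofFn x ++ List.ofFn y ∧ f n x y = true}

/-- The garden-hose complexity of `f` is not bounded by a polynomial in `n`. -/
def BoolFamily.SuperpolynomialGH (f : BoolFamily) : Prop :=
  ∀ p : Polynomial ℕ, ∃ n : ℕ, p.eval n < gh (f n)

end GardenHose

namespace GardenHose

/-! By contraposition: if the language of `f` were decided in logarithmic space, every `f n` would
have a garden-hose game with polynomially many pipes (`not_superpolynomialGH_of_mem_classL`). The
machine has polynomially many configurations on inputs `xy`, and each step depends on `x` alone or
on `y` alone, according to the half in which the input head stands. So the players can follow the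
computation, sending the water across whenever the other one has to move.

The obstacle is that a configuration may have many predecessors, while a pipe end carries at most
one connection. The remedy is an Euler tour of the configuration graph. Each node, a configuration
together with the side to process it, gets two pipes, one for flow with the computation and one for
flow against it. Around a node the connections lead water from each incoming pipe to the next
outgoing one, so water arriving from one predecessor first explores the branches behind the later
ones and only then moves on.

There is no need to track the water step by step. The set `Reached` consists of the forward pipes of
the true computation and all pipes of branches that join it behind the computation's own branch. It
contains the tap, it is closed under connections (`reached_segment`, `linkGraph_closed`), and its
loose ends occur only where the computation stops (`onPath_of_reached`), which is arranged to be on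
the side named by the answer. A maximal path cannot leave such a set and must end at a loose end
(`Game.computes_of_invariant`). -/

/-! ### Maximal paths and an invariant criterion for games -/

theorem exists_isMaximalPath {V : Type*} [Finite V] (H : SimpleGraph V) (u : V) :
    ∃ (v : V) (p : H.Walk u v), IsMaximalPath p := by
  classical
  have := Fintype.ofFinite V
  by_contra! hcon
  have key : ∀ k : ℕ, ∃ (v : V) (p : H.Walk u v), p.IsPath ∧ p.length = k := by
    intro k
    induction k with
    | zero => exact ⟨u, .nil, by simp, rfl⟩
    | succ k ih =>
      obtain ⟨v, p, hp, hk⟩ := ih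
      have := hcon v p
      simp only [IsMaximalPath, not_and, not_forall] at this
      obtain ⟨w, hw, hw'⟩ := this hp
      exact ⟨w, p.concat hw, hp.concat hw' hw, by simp [hk]⟩
  obtain ⟨v, p, hp, hk⟩ := key (Fintype.card V)
  exact absurd hp.length_lt (by omega)

theorem IsMaximalPath.not_adj {V : Type*} {H : SimpleGraph V} {u w : V} {p : H.Walk u u}
    (hp : IsMaximalPath p) : ¬ H.Adj u w := by
  intro h
  have hn := SimpleGraph.Walk.eq_nil_iff_nil.2 (SimpleGraph.Walk.isPath_iff_nil.1 hp.1)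
  have := hp.2 _ h
  rw [hn] at this
  simp only [SimpleGraph.Walk.support_nil, List.mem_singleton] at this
  exact H.irrefl (this ▸ h)

/-- If the first vertex has at most one neighbour and every vertex has at most two, then the last
vertex of a maximal path has at most one neighbour. -/
theorem IsMaximalPath.eq_of_adj {V : Type*} {H : SimpleGraph V} {u v : V} {p : H.Walk u v}
    (hp : IsMaximalPath p) (hu : ∀ a b, H.Adj u a → H.Adj u b → a = b)
    (hdeg : ∀ w a b c, H.Adj w a → H.Adj w b → H.Adj w c → a = b ∨ a = c ∨ b = c)
    {a b : V} (ha : H.Adj v a) (hb : H.Adj v b) : a = b := by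
  have inj := hp.1.getVert_injOn
  -- Every neighbour of the end lies on the path. One other than the penultimate vertex would have
  -- too many neighbours: its successor on the path, the end and, unless it is the first vertex, its
  -- predecessor.
  have key : ∀ a, H.Adj v a → a = p.getVert (p.length - 1) := by
    intro a ha
    obtain ⟨i, rfl, hi⟩ := SimpleGraph.Walk.mem_support_iff_exists_getVert.1 (hp.2 a ha)
    by_contra hne
    have hil : i ≠ p.length := by
      rintro rfl
      simp at ha
    have hi1 : i + 1 < p.length := by
      have : i ≠ p.length - 1 := fun h => hne (by rw [h])
      omega
    have h1 := p.adj_getVert_succ (i := i) (by omega)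
    have hv : H.Adj (p.getVert i) (p.getVert p.length) := by simpa using ha.symm
    have h1v : p.getVert (i + 1) ≠ p.getVert p.length := fun h => by
      have := inj (by simp; omega) (by simp) h
      omega
    cases i with
    | zero => exact h1v (hu _ _ (by simpa using h1) (by simpa using hv))
    | succ i =>
      have h0 := (p.adj_getVert_succ (i := i) (by omega)).symm
      rcases hdeg _ _ _ _ h0 h1 hv with h | h | h
      · have := inj (by simp; omega) (by simp; omega) h
        omega
      · have := inj (by simp; omega) (by simp) h
        omega
      · exact h1v h
  rw [key a ha, key b hb]

/-- A game computes `f` if for all inputs there is a set of pipes, closed under the connections and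
fed by the tap, all of whose loose ends are on the side that `f` prescribes. -/
theorem Game.computes_of_invariant {n s : ℕ} (G : Game n s)
    (f : (Fin n → Bool) → (Fin n → Bool) → Bool)
    (h : ∀ x y, ∃ S : Option (Fin s) → Prop, S none ∧
      (∀ a b, (G.EA x).Adj a b → S a → S b) ∧
      (∀ i j, (G.EB y).Adj i j → S (some i) → S (some j)) ∧
      (∀ a, S a → (∀ b, ¬ (G.EA x).Adj a b) → f x y = false) ∧
      (∀ i, S (some i) → (∀ j, ¬ (G.EB y).Adj i j) → f x y = true)) :
    G.Computes f := by
  intro x y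
  obtain ⟨S, h0, hA, hB, hfA, hfB⟩ := h x y
  obtain ⟨v, p, hp⟩ := exists_isMaximalPath (G.graph x y) Game.tap
  let S' : Option (Fin s) ⊕ Fin s → Prop := Sum.elim S (fun i => S (some i))
  have step : ∀ a b, (G.graph x y).Adj a b → S' a → S' b := by
    rintro (a | a) (b | b) hab ha
    · exact hA _ _ hab ha
    · change a = some b at hab
      subst hab
      exact ha
    · change b = some a at hab
      subst hab
      exact ha
    · exact hB _ _ hab ha
  have walk : ∀ {a b} (_ : (G.graph x y).Walk a b), S' a → S' b := by
    intro a b q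
    induction q with
    | nil => exact id
    | cons hab _ ih => exact fun ha => ih (step _ _ hab ha)
  have hv : S' v := walk p h0
  have hu : ∀ a b, (G.graph x y).Adj Game.tap a → (G.graph x y).Adj Game.tap b → a = b := by
    rintro (a | a) (b | b) ha hb
    · exact congrArg _ (G.degA x _ _ _ ha hb)
    · exact absurd (show none = some b from hb) (by simp)
    · exact absurd (show none = some a from ha) (by simp)
    · exact absurd (show none = some a from ha) (by simp)
  have hdeg : ∀ w a b c, (G.graph x y).Adj w a → (G.graph x y).Adj w b → (G.graph x y).Adj w c →
      a = b ∨ a = c ∨ b = c := by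
    have pipe : ∀ w : Option (Fin s) ⊕ Fin s, ∀ a b, (G.graph x y).Adj w a →
        (G.graph x y).Adj w b → a.isLeft = b.isLeft → a = b := by
      rintro (w | w) (a | a) (b | b) ha hb hab
      · exact congrArg _ (G.degA x _ _ _ ha hb)
      · simp at hab
      · simp at hab
      · change w = some a at ha
        change w = some b at hb
        simp_all
      · change a = some w at ha
        change b = some w at hb
        simp_all
      · simp at hab
      · simp at hab
      · exact congrArg _ (G.degB y _ _ _ ha hb)
    intro w a b c ha hb hc
    -- Two of three neighbours lie on the same side, and there a vertex has at most one.
    by_cases h1 : a.isLeft = b.isLeft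
    · exact .inl (pipe w a b ha hb h1)
    by_cases h2 : a.isLeft = c.isLeft
    · exact .inr (.inl (pipe w a c ha hc h2))
    · refine .inr (.inr (pipe w b c hb hc ?_))
      grind
  refine ⟨v, p, hp, ?_⟩
  rcases v with a | i
  · have : f x y = false := by
      refine hfA a hv fun b hab => ?_
      have hab' : (G.graph x y).Adj (.inl a) (.inl b) := hab
      cases a with
      | none =>
        exact hp.not_adj hab'
      | some i =>
        have h2 : (G.graph x y).Adj (.inl (some i)) (.inr i) := rfl
        have := hp.eq_of_adj hu hdeg hab' h2
        simp at this
    simp [this]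
  · have : f x y = true := by
      refine hfB i hv fun j hij => ?_
      have hij' : (G.graph x y).Adj (.inr i) (.inr j) := hij
      have h2 : (G.graph x y).Adj (.inr i) (.inl (some i)) := rfl
      have := hp.eq_of_adj hu hdeg hij' h2
      simp at this
    simp [this]

/-- The criterion of `Game.computes_of_invariant` with pipes in an arbitrary finite type. -/
theorem gh_le_card {n : ℕ} {P : Type*} [Fintype P]
    (f : (Fin n → Bool) → (Fin n → Bool) → Bool)
    (EA : (Fin n → Bool) → SimpleGraph (Option P)) (EB : (Fin n → Bool) → SimpleGraph P)
    (degA : ∀ x, MaxDegLeOne (EA x)) (degB : ∀ y, MaxDegLeOne (EB y))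
    (h : ∀ x y, ∃ S : Option P → Prop, S none ∧
      (∀ a b, (EA x).Adj a b → S a → S b) ∧
      (∀ i j, (EB y).Adj i j → S (some i) → S (some j)) ∧
      (∀ a, S a → (∀ b, ¬ (EA x).Adj a b) → f x y = false) ∧
      (∀ i, S (some i) → (∀ j, ¬ (EB y).Adj i j) → f x y = true)) :
    gh f ≤ Fintype.card P := by
  let e := (Fintype.equivFin P).symm
  let e' := e.optionCongr
  let G : Game n (Fintype.card P) :=
    { EA := fun x => (EA x).comap e'
      EB := fun y => (EB y).comap e
      degA := fun x u v w hv hw => e'.injective (degA x _ _ _ hv hw)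
      degB := fun y u v w hv hw => e.injective (degB y _ _ _ hv hw) }
  refine Nat.sInf_le ⟨G, G.computes_of_invariant f fun x y => ?_⟩
  obtain ⟨S, h0, hA, hB, hfA, hfB⟩ := h x y
  refine ⟨fun a => S (e' a), h0, fun a b hab ha => hA _ _ hab ha, fun i j hij hi => hB _ _ hij hi,
    fun a ha hn => hfA _ ha fun b hb => hn (e'.symm b) ?_,
    fun i hi hn => hfB _ hi fun j hj => hn (e.symm j) ?_⟩
  · change (EA x).Adj (e' a) (e' (e'.symm b))
    simpa using hb
  · change (EB y).Adj (e i) (e (e.symm j))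
    simpa using hj

/-! ### Traversing a forest with two kinds of edges -/

/-- The pipes of the traversal: a side (`false` for Alice, `true` for Bob), a configuration about to
be processed on that side, and a direction (`true` is with the computation). -/
abbrev Dart (C : Type*) := (Bool × C) × Bool

section Link

variable {C : Type*} {N : ℕ} (own : Bool) (τ : Option C) (φ : C → Option C) (idx : C ≃ Fin N)

/-- The configuration on the other side around which a pipe (or the tap) is arranged. -/
def linkKey : Option (Dart C) → Option C
  | none => τ
  | some ((s, c), _) => if s = own then φ c else some c

/-- The place of a pipe in the tour around its configuration. -/
def linkRank : Option (Dart C) → ℕ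
  | none => 1
  | some ((s, c), d) =>
    -- With `i = idx c` for a predecessor `c`, the tour reads: return pipe of the configuration
    -- itself (0, entry), tap (1, entry), return and forward pipes of `c` (`2i+2` exit, `2i+3`
    -- entry), forward pipe of the configuration itself (`2N+4`, exit).
    if s = own then 2 * idx c + (if d then 3 else 2) else if d then 2 * N + 4 else 0

/-- The water enters the side through this pipe. -/
def IsEntry : Option (Dart C) → Prop
  | none => True
  | some ((s, _), d) => (s = own ↔ d = true)

/-- An entry is followed by an exit in the tour around the same configuration. -/
def Link (a b : Option (Dart C)) : Prop :=
  IsEntry own a ∧ ¬ IsEntry own b ∧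
    ∃ u, linkKey own τ φ a = some u ∧ linkKey own τ φ b = some u ∧
      linkRank own idx a < linkRank own idx b ∧
      ∀ d, linkKey own τ φ d = some u →
        ¬ (linkRank own idx a < linkRank own idx d ∧ linkRank own idx d < linkRank own idx b)

def linkGraph : SimpleGraph (Option (Dart C)) := SimpleGraph.fromRel (Link own τ φ idx)

variable {own τ φ idx}

theorem linkRank_inj {a b : Option (Dart C)} {u : C} (ha : linkKey own τ φ a = some u)
    (hb : linkKey own τ φ b = some u) (h : linkRank own idx a = linkRank own idx b) : a = b := by
  have inj : ∀ c c' : C, (idx c : ℕ) = idx c' → c = c' :=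
    fun c c' h => idx.injective (Fin.ext h)
  rcases a with _ | ⟨⟨s, c⟩, d⟩ <;> rcases b with _ | ⟨⟨s', c'⟩, d'⟩
  · rfl
  · simp only [linkRank] at h
    split_ifs at h <;> omega
  · simp only [linkRank] at h
    split_ifs at h <;> omega
  · have h1 := (idx c).2
    have h2 := (idx c').2
    simp only [linkRank] at h
    simp only [linkKey] at ha hb
    have := inj c c'
    cases s <;> cases s' <;> cases own <;> cases d <;> cases d' <;> simp at h ha hb ⊢ <;>
      first | omega | (apply this; omega) | simp_all

theorem linkGraph_maxDegLeOne : MaxDegLeOne (linkGraph own τ φ idx) := by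
  have key : ∀ a b c, Link own τ φ idx a b → Link own τ φ idx a c → b = c := by
    rintro a b c ⟨-, -, u, ha, hb, hab, h⟩ ⟨-, -, u', ha', hc, hac, h'⟩
    obtain rfl : u = u' := by simpa [ha] using ha'
    refine linkRank_inj (idx := idx) hb hc ?_
    have := h c hc
    have := h' b hb
    omega
  have key' : ∀ a b c, Link own τ φ idx b a → Link own τ φ idx c a → b = c := by
    rintro a b c ⟨-, -, u, hb, ha, hab, h⟩ ⟨-, -, u', hc, ha', hac, h'⟩
    obtain rfl : u = u' := by simpa [ha] using ha'
    refine linkRank_inj (idx := idx) hb hc ?_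
    have := h c hc
    have := h' b hb
    omega
  intro u v w hv hw
  simp only [linkGraph, SimpleGraph.fromRel_adj] at hv hw
  rcases hv.2 with hv | hv <;> rcases hw.2 with hw | hw
  · exact key _ _ _ hv hw
  · exact absurd hv.1 hw.2.1
  · exact absurd hw.1 hv.2.1
  · exact key' _ _ _ hv hw

/-- A set of pipes that around every configuration is trivial or a final segment of the tour
beginning with an entry is closed under the connections. -/
theorem linkGraph_closed {S : Option (Dart C) → Prop}
    (hS : ∀ u, (∃ P : Prop, ∀ d, linkKey own τ φ d = some u → (S d ↔ P)) ∨
      ∃ θ, IsEntry own θ ∧ linkKey own τ φ θ = some u ∧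
        ∀ d, linkKey own τ φ d = some u → (S d ↔ linkRank own idx θ ≤ linkRank own idx d))
    {a b : Option (Dart C)} (hab : (linkGraph own τ φ idx).Adj a b) (ha : S a) : S b := by
  have key : ∀ a b, Link own τ φ idx a b → (S a ↔ S b) := by
    rintro a b ⟨hea, heb, u, ha, hb, hlt, hcon⟩
    rcases hS u with ⟨P, h⟩ | ⟨θ, hθ, hθu, h⟩
    · rw [h a ha, h b hb]
    · rw [h a ha, h b hb]
      refine ⟨fun h => by omega, fun h => ?_⟩
      have h1 := hcon θ hθu
      by_contra h2
      -- Linked pipes are neighbours in the tour, so a segment separating them would have to begin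
      -- at the exit `b`; but it begins at an entry.
      have : θ = b := linkRank_inj (idx := idx) hθu hb (by omega)
      exact heb (this ▸ hθ)
  simp only [linkGraph, SimpleGraph.fromRel_adj] at hab
  rcases hab.2 with h | h
  · exact (key _ _ h).1 ha
  · exact (key _ _ h).2 ha

/-- The only loose ends are those without a configuration to go round, and the one before the tap. -/
theorem exists_linkGraph_adj {a : Option (Dart C)} {u : C} (ha : linkKey own τ φ a = some u)
    (hτ : ¬ (τ = some u ∧ a = some ((!own, u), false))) :
    ∃ b, (linkGraph own τ φ idx).Adj a b := by
  have hdn : linkKey own τ φ (some ((!own, u), true)) = some u := by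
    cases own <;> simp [linkKey]
  have hup : linkKey own τ φ (some ((!own, u), false)) = some u := by
    cases own <;> simp [linkKey]
  by_cases hea : IsEntry own a
  · have hne : ({b | linkKey own τ φ b = some u ∧ linkRank own idx a < linkRank own idx b} :
        Set (Option (Dart C))).Nonempty := by
      refine ⟨_, hdn, ?_⟩
      rcases a with _ | ⟨⟨s, c⟩, d⟩
      · cases own <;> simp [linkRank]
      · cases own <;> cases s <;> cases d <;> simp [linkRank, IsEntry] at hea ⊢
    obtain ⟨b, ⟨hb, hab⟩, hmin⟩ :=
      (measure (linkRank own idx)).wf.has_min _ hne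
    refine ⟨b, ?_⟩
    simp only [linkGraph, SimpleGraph.fromRel_adj]
    refine ⟨by rintro rfl; omega, .inl ⟨hea, ?_, u, ha, hb, hab,
      fun d hd h => hmin d ⟨hd, h.1⟩ h.2⟩⟩
    intro heb
    rcases b with _ | ⟨⟨s', c'⟩, d'⟩
    -- Only the return pipe at place 0 precedes the tap directly; two entries in a row leave it
    -- loose.
    · refine hτ ⟨hb, ?_⟩
      rcases a with _ | ⟨⟨s, c⟩, d⟩
      · omega
      · cases own <;> cases s <;> cases d <;>
          simp [linkRank, IsEntry, linkKey] at hab ha hea ⊢ <;> omega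
    · by_cases hs : s' = own
      -- A predecessor's forward entry comes right after its own return exit, so it cannot be the
      -- first pipe behind an entry.
      · subst hs
        have hd' : d' = true := by simpa [IsEntry] using heb
        subst hd'
        have hb' : linkKey s' τ φ (some ((s', c'), false)) = some u := by
          simpa [linkKey] using hb
        have hr : linkRank s' idx (some ((s', c'), true)) =
            linkRank s' idx (some ((s', c'), false)) + 1 := by simp [linkRank]
        refine hmin _ ⟨hb', ?_⟩ (show linkRank s' idx _ < linkRank s' idx _ by omega)
        rw [hr] at hab
        refine lt_of_le_of_ne (by omega) fun h => ?_
        have := linkRank_inj (idx := idx) ha hb' h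
        subst this
        simp [IsEntry] at hea
      · have hd' : d' = false := by simpa [IsEntry, hs] using heb
        subst hd'
        simp [linkRank, hs] at hab
  · have hne : ({b | linkKey own τ φ b = some u ∧ linkRank own idx b < linkRank own idx a} :
        Set (Option (Dart C))).Nonempty := by
      refine ⟨_, hup, ?_⟩
      rcases a with _ | ⟨⟨s, c⟩, d⟩
      · cases own <;> simp [linkRank]
      · cases own <;> cases s <;> cases d <;> simp [linkRank, IsEntry] at hea ⊢
    have hfin : ∀ b : Option (Dart C), linkRank own idx b ≤ 2 * N + 4 := by
      rintro (_ | ⟨⟨s, c⟩, d⟩)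
      · simp [linkRank]
      · have := (idx c).2
        cases own <;> cases s <;> cases d <;> simp [linkRank] <;> omega
    obtain ⟨b, ⟨hb, hab⟩, hmax⟩ :=
      (measure fun b => 2 * N + 4 - linkRank own idx b).wf.has_min _ hne
    have hmax : ∀ d, linkKey own τ φ d = some u → linkRank own idx d < linkRank own idx a →
        linkRank own idx d ≤ linkRank own idx b := by
      intro d hd hda
      have := hmax d ⟨hd, hda⟩
      change ¬ (2 * N + 4 - linkRank own idx d < 2 * N + 4 - linkRank own idx b) at this
      have := hfin a
      omega
    refine ⟨b, ?_⟩
    simp only [linkGraph, SimpleGraph.fromRel_adj]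
    refine ⟨by rintro rfl; omega, .inr ⟨?_, hea, u, hb, ha, hab,
      fun d hd h => (hmax d hd h.2).not_gt h.1⟩⟩
    by_contra heb
    rcases b with _ | ⟨⟨s', c'⟩, d'⟩
    · exact heb trivial
    · by_cases hs : s' = own
      · subst hs
        have hd' : d' = false := by simpa [IsEntry] using heb
        subst hd'
        have hb' : linkKey s' τ φ (some ((s', c'), true)) = some u := by
          simpa [linkKey] using hb
        have hr : linkRank s' idx (some ((s', c'), true)) =
            linkRank s' idx (some ((s', c'), false)) + 1 := by simp [linkRank]
        have := hmax _ hb' (lt_of_le_of_ne (by omega) fun h => ?_)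
        · omega
        · have := linkRank_inj (idx := idx) ha hb' h.symm
          subst this
          simp [IsEntry] at hea
      · have hd' : d' = true := by simpa [IsEntry, hs] using heb
        subst hd'
        have h1 := hfin a
        have h2 : linkRank own idx (some ((s', c'), true)) = 2 * N + 4 := by simp [linkRank, hs]
        omega

end Link

/-! ### The computation path and the pipes the water may reach -/

section Path

variable {C : Type*} {N : ℕ} (c₀ : C) (φ : Bool → C → Option C) (idx : C ≃ Fin N)

/-- One move of the alternating computation; `none` stands for the tap, which imitates the initial
configuration on Alice's side. -/
def nextNode (p : Option (Bool × C)) : Option (Option (Bool × C)) :=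
  (φ (p.getD (false, c₀)).1 (p.getD (false, c₀)).2).map
    fun c => some (!(p.getD (false, c₀)).1, c)

/-- The alternating computation that starts at the tap. -/
def trace : ℕ → Option (Option (Bool × C))
  | 0 => some none
  | i + 1 => (trace i).bind (nextNode c₀ φ)

def OnPath (p : Option (Bool × C)) : Prop := ∃ i, trace c₀ φ i = some p

/-- The rank of a node among its siblings. -/
def nodeRank : Option (Bool × C) → ℕ
  | none => 0
  | some w => idx w.2 + 1

/-- The nodes off the computation path whose branch joins the path after the path's own branch. -/
inductive RightOf : Bool × C → Prop
  | side {p z w} : OnPath c₀ φ p → nextNode c₀ φ p = some z → nextNode c₀ φ (some w) = some z →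
      ¬ OnPath c₀ φ (some w) → nodeRank idx p < nodeRank idx (some w) → RightOf w
  | branch {w z} : nextNode c₀ φ (some w) = some (some z) → RightOf z → RightOf w

/-- The pipes that the water may reach. -/
def Reached : Option (Dart C) → Prop
  | none => True
  -- On the path the water only flows forward; a branch to the right is toured in both directions.
  | some (w, d) => (OnPath c₀ φ (some w) ∧ d = true) ∨ RightOf c₀ φ idx w

/-- The configuration at which a side attaches the tap. -/
def tapKey : Bool → Option C
  | false => φ false c₀
  | true => none

variable {c₀ φ idx}

theorem OnPath.next {p z : Option (Bool × C)} (h : OnPath c₀ φ p) (hz : nextNode c₀ φ p = some z) :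
    OnPath c₀ φ z := by
  obtain ⟨i, hi⟩ := h
  exact ⟨i + 1, by simp [trace, hi, hz]⟩

theorem OnPath.tap : OnPath c₀ φ none := ⟨0, rfl⟩

theorem OnPath.exists_prev {w : Bool × C} (h : OnPath c₀ φ (some w)) :
    ∃ p, OnPath c₀ φ p ∧ nextNode c₀ φ p = some (some w) := by
  obtain ⟨i, hi⟩ := h
  cases i with
  | zero => simp [trace] at hi
  | succ i =>
    simp only [trace, Option.bind_eq_some_iff] at hi
    obtain ⟨p, hp, hw⟩ := hi
    exact ⟨p, ⟨i, hp⟩, hw⟩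

/-- Two different path nodes with the same successor would make the trace periodic, and it would
never stop. -/
theorem OnPath.prev_unique (hJ : ∃ J, trace c₀ φ J = none) {p q z : Option (Bool × C)}
    (hp : OnPath c₀ φ p) (hq : OnPath c₀ φ q) (hpz : nextNode c₀ φ p = some z)
    (hqz : nextNode c₀ φ q = some z) : p = q := by
  classical
  have key : ∀ i j p q, trace c₀ φ i = some p → trace c₀ φ j = some q →
      nextNode c₀ φ p = some z → nextNode c₀ φ q = some z → ¬ i < j := by
    intro i j p q hi hj hp hq hij
    have hi' : trace c₀ φ (i + 1) = some z := by simp [trace, hi, hp]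
    have hj' : trace c₀ φ (j + 1) = some z := by simp [trace, hj, hq]
    have per : ∀ k, trace c₀ φ (i + 1 + k) = trace c₀ φ (j + 1 + k) := by
      intro k
      induction k with
      | zero => simp [hi', hj']
      | succ k ih =>
        change (trace c₀ φ (i + 1 + k)).bind _ = (trace c₀ φ (j + 1 + k)).bind _
        rw [ih]
    have some_of_le : ∀ k, ∀ l ≤ k, trace c₀ φ k ≠ none → trace c₀ φ l ≠ none := by
      intro k
      induction k with
      | zero => intro l hl; simp_all
      | succ k ih =>
        intro l hl hk
        rcases Nat.lt_or_ge k l with h | h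
        · obtain rfl : l = k + 1 := by omega
          exact hk
        · refine ih l h fun h0 => hk (by simp [trace, h0])
    have hlt : j + 1 < Nat.find hJ := by
      by_contra hle
      exact some_of_le (j + 1) _ (not_lt.1 hle) (by simp [hj']) (Nat.find_spec hJ)
    have := per (Nat.find hJ - (j + 1))
    rw [Nat.add_sub_cancel' hlt.le, Nat.find_spec hJ] at this
    exact Nat.find_min hJ (by omega) this
  obtain ⟨i, hi⟩ := hp
  obtain ⟨j, hj⟩ := hq
  rcases lt_trichotomy i j with h | rfl | h
  · exact (key i j p q hi hj hpz hqz h).elim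
  · simpa [hi] using hj
  · exact (key j i q p hj hi hqz hpz h).elim

theorem RightOf.not_onPath {w : Bool × C} (h : RightOf c₀ φ idx w) : ¬ OnPath c₀ φ (some w) := by
  induction h with
  | side _ _ _ h => exact h
  | branch h _ ih => exact fun hw => ih (hw.next h)

/-- This keeps the branches free of loose ends: each of them runs into the path. -/
theorem RightOf.exists_next {w : Bool × C} (h : RightOf c₀ φ idx w) :
    nextNode c₀ φ (some w) ≠ none := by
  cases h with
  | side _ _ h => simp [h]
  | branch h => simp [h]

theorem nextNode_none : nextNode c₀ φ none = (φ false c₀).map fun c => some (true, c) := rfl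

theorem nextNode_some (s : Bool) (c : C) :
    nextNode c₀ φ (some (s, c)) = (φ s c).map fun c => some (!s, c) := rfl

/-- Around every configuration, the reached pipes are all, none, or those after the path. -/
theorem reached_segment (hJ : ∃ J, trace c₀ φ J = none) (own : Bool) (u : C) :
    (∃ P : Prop, ∀ d, linkKey own (tapKey c₀ φ own) (φ own) d = some u →
      (Reached c₀ φ idx d ↔ P)) ∨
    ∃ θ, IsEntry own θ ∧ linkKey own (tapKey c₀ φ own) (φ own) θ = some u ∧
      ∀ d, linkKey own (tapKey c₀ φ own) (φ own) d = some u →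
        (Reached c₀ φ idx d ↔ linkRank own idx θ ≤ linkRank own idx d) := by
  have htap : tapKey c₀ φ own = some u → nextNode c₀ φ none = some (some (!own, u)) := by
    intro h
    cases own with
    | true => simp [tapKey] at h
    | false =>
      change φ false c₀ = some u at h
      simp [nextNode_none, h]
  have hchild : ∀ c, φ own c = some u → nextNode c₀ φ (some (own, c)) = some (some (!own, u)) :=
    fun c h => by simp [nextNode_some, h]
  by_cases hu : OnPath c₀ φ (some (!own, u))
  · right
    obtain ⟨p, hp, hpu⟩ := hu.exists_prev
    -- `θ` is the pipe, or the tap, through which the path itself enters; everything from there on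
    -- in the tour is reached.
    obtain ⟨θ, hθe, hθu, hθr⟩ : ∃ θ, IsEntry own θ ∧
        linkKey own (tapKey c₀ φ own) (φ own) θ = some u ∧
        linkRank own idx θ = 2 * nodeRank idx p + 1 := by
      rcases p with _ | ⟨s, c⟩
      · refine ⟨none, trivial, ?_, rfl⟩
        simp only [nextNode_none, Option.map_eq_some_iff, Option.some.injEq, Prod.mk.injEq] at hpu
        obtain ⟨a, ha, h1, rfl⟩ := hpu
        cases own
        · exact ha
        · simp at h1
      · refine ⟨some ((s, c), true), ?_⟩
        simp only [nextNode_some, Option.map_eq_some_iff, Option.some.injEq, Prod.mk.injEq,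
          Bool.not_eq_eq_eq_not, Bool.not_not] at hpu
        obtain ⟨a, ha, rfl, rfl⟩ := hpu
        simp [IsEntry, linkKey, linkRank, nodeRank, ha]
        omega
    refine ⟨θ, hθe, hθu, ?_⟩
    have hrp : nodeRank idx p ≤ N := by
      rcases p with _ | ⟨s, c⟩
      · simp [nodeRank]
      · have := (idx c).2
        simp only [nodeRank]
        omega
    rintro (_ | ⟨⟨s, c⟩, d⟩) hd
    · have : none = p := OnPath.tap.prev_unique hJ hp (htap hd) hpu
      subst this
      rw [hθr]
      simp [Reached, nodeRank, linkRank]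
    · by_cases hs : s = own
      · subst hs
        have hc : φ s c = some u := by simpa [linkKey] using hd
        by_cases hon : OnPath c₀ φ (some (s, c))
        · have : some (s, c) = p := hon.prev_unique hJ hp (hchild c hc) hpu
          subst this
          have hn : ¬ RightOf c₀ φ idx (s, c) := fun h => h.not_onPath hon
          rw [hθr]
          simp only [Reached, hon, hn, nodeRank, linkRank]
          cases d <;> simp <;> omega
        · have hne : nodeRank idx p ≠ nodeRank idx (some (s, c)) := by
            intro h
            rcases p with _ | ⟨s', c'⟩
            · simp [nodeRank] at h
            · have hcc : c' = c := idx.injective (Fin.ext (by simpa [nodeRank] using h))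
              have hss : s' = s := by
                simp only [nextNode_some, Option.map_eq_some_iff, Option.some.injEq,
                  Prod.mk.injEq] at hpu
                obtain ⟨a, -, h1, -⟩ := hpu
                simpa using h1
              exact hon (hcc ▸ hss ▸ hp)
          have hR : RightOf c₀ φ idx (s, c) ↔ nodeRank idx p < nodeRank idx (some (s, c)) := by
            constructor
            · intro h
              cases h with
              | @side p' z _ hp' hz hwz _ hlt =>
                obtain rfl : some (!s, u) = z := by simpa [hchild c hc] using hwz
                rwa [hp.prev_unique hJ hp' hpu hz]
              | branch h h' =>
                rw [hchild c hc] at h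
                simp only [Option.some.injEq] at h
                subst h
                exact absurd hu h'.not_onPath
            · exact fun h => .side hp hpu (hchild c hc) hon h
          rw [hθr]
          simp only [Reached, hon, false_and, false_or, hR, linkRank, if_true]
          generalize nodeRank idx p = r at hne ⊢
          simp only [nodeRank] at hne ⊢
          cases d <;> simp <;> omega
      · have hcu : c = u := by simpa [linkKey, hs] using hd
        have hs' : s = !own := by cases s <;> cases own <;> simp_all
        subst hcu hs'
        have hn : ¬ RightOf c₀ φ idx (!own, c) := fun h => h.not_onPath hu
        rw [hθr]
        simp only [Reached, hu, hn, linkRank]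
        cases d <;> simp; omega
  · left
    -- Off the path, membership in `RightOf` passes unchanged between a node and its predecessors.
    refine ⟨RightOf c₀ φ idx (!own, u), ?_⟩
    rintro (_ | ⟨⟨s, c⟩, d⟩) hd
    · exact absurd (OnPath.tap.next (htap hd)) hu
    · by_cases hs : s = own
      · subst hs
        have hc : φ s c = some u := by simpa [linkKey] using hd
        have hon : ¬ OnPath c₀ φ (some (s, c)) := fun h => hu (h.next (hchild c hc))
        simp only [Reached, hon, false_and, false_or]
        refine ⟨fun h => ?_, fun h => .branch (hchild c hc) h⟩
        cases h with
        | @side p' z _ hp' hz hwz _ hlt =>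
          obtain rfl : some (!s, u) = z := by simpa [hchild c hc] using hwz
          exact absurd (hp'.next hz) hu
        | branch h h' =>
          rw [hchild c hc] at h
          simp only [Option.some.injEq] at h
          rwa [h]
      · have hcu : c = u := by simpa [linkKey, hs] using hd
        have hs' : s = !own := by cases s <;> cases own <;> simp_all
        subst hcu hs'
        simp [Reached, hu]

/-- A reached loose end is a node at which the computation path stops. -/
theorem onPath_of_reached (own : Bool) {a : Option (Dart C)} (ha : Reached c₀ φ idx a)
    (hadj : ∀ b, ¬ (linkGraph own (tapKey c₀ φ own) (φ own) idx).Adj a b) :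
    (a = none ∧ tapKey c₀ φ own = none) ∨
      ∃ c, OnPath c₀ φ (some (own, c)) ∧ φ own c = none := by
  cases hk : linkKey own (tapKey c₀ φ own) (φ own) a with
  | some u =>
    exfalso
    -- The loose return pipe before the tap stays dry: its node lies on the path, whose return pipes
    -- are not reached.
    by_cases hτ : tapKey c₀ φ own = some u ∧ a = some ((!own, u), false)
    · obtain ⟨h1, rfl⟩ := hτ
      have hown : own = false := by
        cases own
        · rfl
        · simp [tapKey] at h1
      subst hown
      have hu : OnPath c₀ φ (some (true, u)) := by
        refine OnPath.tap.next ?_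
        change φ false c₀ = some u at h1
        simp [nextNode_none, h1]
      simp only [Reached, Bool.not_false, Bool.false_eq_true, and_false, false_or] at ha
      exact ha.not_onPath hu
    · obtain ⟨b, hb⟩ := exists_linkGraph_adj (idx := idx) hk hτ
      exact hadj b hb
  | none =>
    rcases a with _ | ⟨⟨s, c⟩, d⟩
    · exact .inl ⟨rfl, hk⟩
    · right
      by_cases hs : s = own
      · subst hs
        have hc : φ s c = none := by simpa [linkKey] using hk
        refine ⟨c, ?_, hc⟩
        rcases ha with h | h
        · exact h.1
        · exact absurd (by simp [nextNode_some, hc]) h.exists_next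
      · simp [linkKey, hs] at hk

end Path

/-- A computation in which every step depends on only one of the two inputs can be followed by a
garden-hose game with four pipes for each configuration. -/
theorem gh_le_four_mul_card {n : ℕ} {C : Type*} [Fintype C]
    (f : (Fin n → Bool) → (Fin n → Bool) → Bool) (c₀ : C) (halt : C → Option Bool)
    (stepA stepB : (Fin n → Bool) → C → C) (run : (Fin n → Bool) → (Fin n → Bool) → ℕ → C)
    (h0 : ∀ x y, run x y 0 = c₀)
    (hstep : ∀ x y t,
      (stepA x (run x y t) = run x y (t + 1) ∧ stepB y (run x y t) = run x y t) ∨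
      (stepA x (run x y t) = run x y t ∧ stepB y (run x y t) = run x y (t + 1)))
    (hhalt : ∀ x y, ∃ t b, halt (run x y t) = some b ∧
      stepA x (run x y t) = run x y t ∧ stepB y (run x y t) = run x y t)
    (hf : ∀ x y t b, halt (run x y t) = some b → f x y = b) :
    gh f ≤ 4 * Fintype.card C := by
  classical
  let idx := Fintype.equivFin C
  -- Each player stops only at halting configurations whose output is the player's own side. At a
  -- configuration where it is the other's turn, the step is idle and merely passes the water
  -- across.
  let φA : (Fin n → Bool) → C → Option C :=
    fun x c => if halt c = some false then none else some (stepA x c)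
  let φB : (Fin n → Bool) → C → Option C :=
    fun y c => if halt c = some true then none else some (stepB y c)
  have hcard : Fintype.card (Dart C) = 4 * Fintype.card C := by
    simp only [Fintype.card_prod, Fintype.card_bool]
    ring
  rw [← hcard]
  refine gh_le_card f (fun x => linkGraph false (φA x c₀) (φA x) idx)
    (fun y => (linkGraph true none (φB y) idx).comap some)
    (fun x => linkGraph_maxDegLeOne)
    (fun y u v w hv hw => Option.some_injective _ (linkGraph_maxDegLeOne _ _ _ hv hw)) ?_
  intro x y
  let φ : Bool → C → Option C := fun s => if s then φB y else φA x
  have hφ : ∀ s t, φ s (run x y t) = none → f x y = s := by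
    intro s t h
    cases s
    · simp only [φ, φA, Bool.false_eq_true, if_false, ite_eq_left_iff, reduceCtorEq, imp_false,
        not_not] at h
      exact hf x y t _ h
    · simp only [φ, φB, if_true, ite_eq_left_iff, reduceCtorEq, imp_false,
        not_not] at h
      exact hf x y t _ h
  have hφstep : ∀ s t c, φ s (run x y t) = some c → ∃ t', c = run x y t' := by
    intro s t c h
    have hst := hstep x y t
    cases s
    · simp only [φ, φA, Bool.false_eq_true, if_false, Option.ite_none_left_eq_some,
        Option.some.injEq] at h
      rw [← h.2]
      rcases hst with h | h
      · exact ⟨_, h.1⟩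
      · exact ⟨_, h.1⟩
    · simp only [φ, φB, if_true, Option.ite_none_left_eq_some,
        Option.some.injEq] at h
      rw [← h.2]
      rcases hst with h | h
      · exact ⟨_, h.2⟩
      · exact ⟨_, h.2⟩
  have hrun : ∀ i p, trace c₀ φ i = some p → ∃ t, (p.getD (false, c₀)).2 = run x y t := by
    intro i
    induction i with
    | zero =>
      intro p hp
      obtain rfl : none = p := by simpa [trace] using hp
      exact ⟨0, (h0 x y).symm⟩
    | succ i ih =>
      intro p hp
      simp only [trace, Option.bind_eq_some_iff] at hp
      obtain ⟨q, hq, hqp⟩ := hp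
      obtain ⟨t, ht⟩ := ih q hq
      simp only [nextNode, Option.map_eq_some_iff] at hqp
      obtain ⟨c, hc, rfl⟩ := hqp
      rw [ht] at hc
      exact hφstep _ t c hc
  have hJ : ∃ J, trace c₀ φ J = none := by
    by_contra! hJ
    have move : ∀ i p s t, trace c₀ φ i = some p → p.getD (false, c₀) = (s, run x y t) →
        ∃ c, φ s (run x y t) = some c ∧ trace c₀ φ (i + 1) = some (some (!s, c)) := by
      intro i p s t hi hp
      have h := hJ (i + 1)
      have h' : trace c₀ φ (i + 1) = (φ s (run x y t)).map fun c => some (!s, c) := by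
        simp [trace, hi, nextNode, hp]
      cases hc : φ s (run x y t) with
      | none => simp [h', hc] at h
      | some c => exact ⟨c, rfl, by simp [h', hc]⟩
    have hA : ∀ t c, φ false (run x y t) = some c → c = stepA x (run x y t) := by
      intro t c h
      simp only [φ, φA, Bool.false_eq_true, if_false, Option.ite_none_left_eq_some,
        Option.some.injEq] at h
      exact h.2.symm
    have hB : ∀ t c, φ true (run x y t) = some c → c = stepB y (run x y t) := by
      intro t c h
      simp only [φ, φB, if_true, Option.ite_none_left_eq_some, Option.some.injEq] at h
      exact h.2.symm
    -- At most two moves of the trace perform one step of the run: possibly an idle one, then the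
    -- real one. So an endless trace would reach the halting configuration, where within two moves
    -- the side of the answer must stop.
    have reach : ∀ t, ∃ i p s, trace c₀ φ i = some p ∧ p.getD (false, c₀) = (s, run x y t) := by
      intro t
      induction t with
      | zero => exact ⟨0, none, false, rfl, by simp [h0]⟩
      | succ t ih =>
        obtain ⟨i, p, s, hi, hp⟩ := ih
        obtain ⟨c, hc, hi'⟩ := move i p s t hi hp
        have done : c = run x y (t + 1) → ∃ i p s, trace c₀ φ i = some p ∧
            p.getD (false, c₀) = (s, run x y (t + 1)) :=
          fun h => ⟨_, _, !s, hi', by simp [h]⟩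
        have again : c = run x y t → ∃ c', φ (!s) (run x y t) = some c' ∧
            trace c₀ φ (i + 1 + 1) = some (some (!!s, c')) :=
          fun h => move (i + 1) _ (!s) t hi' (by simp [h])
        cases s with
        | false =>
          have hc' := hA t c hc
          rcases hstep x y t with h | h
          · exact done (hc'.trans h.1)
          · obtain ⟨c', h1, h2⟩ := again (hc'.trans h.1)
            exact ⟨_, _, false, h2, by simp [(hB t c' h1).trans h.2]⟩
        | true =>
          have hc' := hB t c hc
          rcases hstep x y t with h | h
          · obtain ⟨c', h1, h2⟩ := again (hc'.trans h.2)
            exact ⟨_, _, true, h2, by simp [(hA t c' h1).trans h.1]⟩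
          · exact done (hc'.trans h.2)
    obtain ⟨t, b, hb, h1, h2⟩ := hhalt x y
    have hnone : φ b (run x y t) = none := by
      cases b <;> simp [φ, φA, φB, hb]
    obtain ⟨i, p, s, hi, hp⟩ := reach t
    obtain ⟨c, hc, hi'⟩ := move i p s t hi hp
    by_cases hs : s = b
    · simp [hs, hnone] at hc
    · have hcr : c = run x y t := by
        cases s
        · exact (hA t c hc).trans h1
        · exact (hB t c hc).trans h2
      obtain ⟨c', hc', -⟩ := move (i + 1) _ (!s) t hi' (by simp [hcr])
      have hs' : (!s) = b := Bool.not_eq.2 hs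
      simp [hs', hnone] at hc'
  refine ⟨Reached c₀ φ idx, trivial, ?_, ?_, ?_, ?_⟩
  · intro a b hab ha
    exact linkGraph_closed (reached_segment hJ false) hab ha
  · intro a b hab ha
    exact linkGraph_closed (reached_segment hJ true) hab ha
  · intro a ha hn
    rcases onPath_of_reached false ha hn with ⟨rfl, h⟩ | ⟨c, ⟨i, hi⟩, hc⟩
    · exact hφ false 0 (by rw [h0]; exact h)
    · obtain ⟨t, ht⟩ := hrun i _ hi
      change c = _ at ht
      exact hφ false t (ht ▸ hc)
  · intro a ha hn
    -- On Bob's side the tap has no key, so dropping it loses no connection.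
    have hn' : ∀ b, ¬ (linkGraph true (tapKey c₀ φ true) (φ true) idx).Adj (some a) b := by
      rintro (_ | b) hb
      · simp only [linkGraph, SimpleGraph.fromRel_adj] at hb
        rcases hb.2 with h | h
        · obtain ⟨-, -, u, -, h, -⟩ := h
          simp [linkKey, tapKey] at h
        · obtain ⟨-, -, u, h, -⟩ := h
          simp [linkKey, tapKey] at h
      · exact hn b hb
    rcases onPath_of_reached true ha hn' with ⟨h, -⟩ | ⟨c, ⟨i, hi⟩, hc⟩
    · simp at h
    · obtain ⟨t, ht⟩ := hrun i _ hi
      change c = _ at ht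
      exact hφ true t (ht ▸ hc)

/-! ### Configurations of space-bounded machines -/

namespace TM

variable (M : TM)

theorem step_congr {w w' : List Bool} {c : M.Cfg} (hlen : w.length = w'.length)
    (hread : readInput w c.inPos = readInput w' c.inPos) : M.step w c = M.step w' c := by
  simp only [step, hlen, hread]

theorem readInput_append_left {u v v' : List Bool} {i : ℕ} (hi : i ≤ u.length) :
    readInput (u ++ v) i = readInput (u ++ v') i := by
  cases i with
  | zero => rfl
  | succ i => simp only [readInput, List.getElem?_append_left (show i < u.length from hi)]

theorem readInput_append_right {u u' v : List Bool} {i : ℕ} (hlen : u.length = u'.length)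
    (hi : u.length < i) : readInput (u ++ v) i = readInput (u' ++ v) i := by
  cases i with
  | zero => omega
  | succ i =>
    simp only [readInput, List.getElem?_append_right (show u.length ≤ i by omega),
      List.getElem?_append_right (show u'.length ≤ i by omega), hlen]

theorem run_succ (w : List Bool) (t : ℕ) : M.run w (t + 1) = M.step w (M.run w t) :=
  Function.iterate_succ_apply' _ _ _

variable {M}

theorem step_of_halt {w : List Bool} {c : M.Cfg} {b : Bool} (h : M.halt c.state = some b) :
    M.step w c = c := by
  simp [step, h]

theorem run_add_of_halt {w : List Bool} {t : ℕ} {b : Bool}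
    (h : M.halt (M.run w t).state = some b) (k : ℕ) : M.run w (t + k) = M.run w t := by
  induction k with
  | zero => rfl
  | succ k ih => rw [← Nat.add_assoc, run_succ, ih, step_of_halt h]

theorem halt_unique {w : List Bool} {t t' : ℕ} {b b' : Bool}
    (h : M.halt (M.run w t).state = some b) (h' : M.halt (M.run w t').state = some b') :
    b = b' := by
  have h1 := run_add_of_halt h t'
  have h2 := run_add_of_halt h' t
  rw [Nat.add_comm, h1] at h2
  rw [h2, h'] at h
  exact (Option.some.inj h).symm

theorem abs_head_step (w : List Bool) (c : M.Cfg) (i : Fin M.k) :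
    |(M.step w c).head i - c.head i| ≤ 1 := by
  unfold step
  split
  · simp
  · simp only
    generalize (_ : M.Γ × Move).2 = m
    cases m <;> simp [moveWork]

theorem inPos_step_le {w : List Bool} {c : M.Cfg} (h : c.inPos ≤ w.length + 1) :
    (M.step w c).inPos ≤ w.length + 1 := by
  unfold step
  split
  · exact h
  · simp only
    generalize (_ : M.State × Move × _).2.1 = m
    cases m <;> simp only [moveInput] <;> omega

theorem tape_step_of_ne {w : List Bool} {c : M.Cfg} {i : Fin M.k} {z : ℤ} (h : z ≠ c.head i) :
    (M.step w c).tape i z = c.tape i z := by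
  unfold step
  split
  · rfl
  · simp only [Function.update_of_ne h]

theorem inPos_run_le (w : List Bool) (t : ℕ) : (M.run w t).inPos ≤ w.length + 1 := by
  induction t with
  | zero => exact Nat.zero_le _
  | succ t ih =>
    rw [run_succ]
    exact inPos_step_le ih

/-- A head visits all the cells between its start and its position. -/
theorem mem_visited_of_between {w : List Bool} {t : ℕ} {i : Fin M.k} {z : ℤ}
    (hz : z ∈ Set.uIcc 0 ((M.run w t).head i)) : (i, z) ∈ M.visited w := by
  induction t with
  | zero =>
    have : z = 0 := by simpa using (show z ∈ Set.uIcc (0 : ℤ) 0 from hz)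
    exact ⟨0, this.symm⟩
  | succ t ih =>
    by_cases h : z ∈ Set.uIcc 0 ((M.run w t).head i)
    · exact ih h
    · refine ⟨t + 1, ?_⟩
      have h1 := abs_head_step w (M.run w t) i
      rw [← run_succ, abs_le] at h1
      rw [Set.mem_uIcc] at hz h
      change (M.run w (t + 1)).head i = z
      omega

theorem abs_head_run_le {w : List Bool} {K : ℕ} (hK : (M.visited w).encard ≤ K) (t : ℕ)
    (i : Fin M.k) : |(M.run w t).head i| ≤ K := by
  have hsub : (fun z => (i, z)) '' Set.uIcc 0 ((M.run w t).head i) ⊆ M.visited w := by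
    rintro _ ⟨z, hz, rfl⟩
    exact mem_visited_of_between hz
  have h1 := (Set.encard_le_encard hsub).trans hK
  rw [(Prod.mk_right_injective i).encard_image, ← Finset.coe_uIcc,
    Set.encard_coe_eq_coe_finsetCard, Int.card_uIcc] at h1
  have h2 : ((M.run w t).head i - 0).natAbs + 1 ≤ K := by exact_mod_cast h1
  rw [abs_le]
  omega

theorem tape_run_eq_blank {w : List Bool} {K : ℕ} (hK : (M.visited w).encard ≤ K) (t : ℕ)
    (i : Fin M.k) {z : ℤ} (hz : (K : ℤ) < |z|) : (M.run w t).tape i z = M.blank := by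
  induction t with
  | zero => rfl
  | succ t ih =>
    have h := abs_head_run_le hK t i
    rw [run_succ, tape_step_of_ne, ih]
    rintro rfl
    omega

variable (M)

/-- The configurations on inputs of length `m` in which only the work tape cells `-K, …, K` are
used. -/
def boundedCfg (m K : ℕ) : Set M.Cfg :=
  {c | c.inPos ≤ m + 1 ∧ (∀ i, |c.head i| ≤ K) ∧
    ∀ i z, (K : ℤ) < |z| → c.tape i z = M.blank}

variable {M}

theorem run_mem_boundedCfg {w : List Bool} {K : ℕ} (hK : (M.visited w).encard ≤ K) (t : ℕ) :
    M.run w t ∈ M.boundedCfg w.length K :=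
  ⟨inPos_run_le w t, fun i => abs_head_run_le hK t i, fun i _ hz => tape_run_eq_blank hK t i hz⟩

/-- The finite part of a bounded configuration. -/
def boundedCfgCode (m K : ℕ) (c : M.boundedCfg m K) :
    M.State × Fin (m + 2) × (Fin M.k → Set.Icc (-K : ℤ) K) ×
      (Fin M.k → Set.Icc (-K : ℤ) K → M.Γ) :=
  (c.1.state, ⟨c.1.inPos, Nat.lt_succ_of_le c.2.1⟩,
    fun i => ⟨c.1.head i, Set.mem_Icc.2 (abs_le.1 (c.2.2.1 i))⟩, fun i z => c.1.tape i z)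

/-- Outside `-K, …, K` both tapes are blank, so the window determines them. -/
theorem boundedCfgCode_injective (m K : ℕ) :
    Function.Injective (boundedCfgCode (M := M) m K) := by
  rintro ⟨⟨q, p, h, T⟩, hc⟩ ⟨⟨q', p', h', T'⟩, hc'⟩ heq
  simp only [boundedCfgCode, Prod.mk.injEq, Fin.mk.injEq, funext_iff, Subtype.mk.injEq] at heq
  obtain ⟨rfl, rfl, h1, h2⟩ := heq
  obtain rfl : h = h' := funext h1
  obtain rfl : T = T' := by
    funext i z
    by_cases hz : |z| ≤ K
    · exact h2 i ⟨z, Set.mem_Icc.2 (abs_le.1 hz)⟩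
    · exact (hc.2.2 i z (not_le.1 hz)).trans (hc'.2.2 i z (not_le.1 hz)).symm
  rfl

theorem finite_boundedCfg (m K : ℕ) : Finite (M.boundedCfg m K) := by
  have := M.finState
  have := M.finΓ
  exact Finite.of_injective _ (boundedCfgCode_injective m K)

theorem card_boundedCfg_le (m K : ℕ) :
    Nat.card (M.boundedCfg m K) ≤ Nat.card M.State * ((m + 2) *
      ((2 * K + 1) ^ M.k * (Nat.card M.Γ ^ (2 * K + 1)) ^ M.k)) := by
  have := M.finState
  have := M.finΓ
  refine (Nat.card_le_card_of_injective _ (boundedCfgCode_injective m K)).trans_eq ?_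
  have hI : Fintype.card (Set.Icc (-K : ℤ) K) = 2 * K + 1 := by
    rw [Fintype.card_ofFinset, Int.card_Icc]
    omega
  simp [Nat.card_prod, Nat.card_fun, hI]

end TM

/-! ### From logarithmic space to polynomially many pipes -/

theorem mem_language_iff (f : BoolFamily) {n : ℕ} (x y : Fin n → Bool) :
    List.ofFn x ++ List.ofFn y ∈ f.language ↔ f n x y = true := by
  constructor
  · rintro ⟨n', x', y', h, hf⟩
    have hlen := congrArg List.length h
    simp only [List.length_append, List.length_ofFn] at hlen
    obtain rfl : n = n' := by omega
    obtain ⟨h1, h2⟩ := List.append_inj h (by simp)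
    rwa [List.ofFn_injective h1, List.ofFn_injective h2]
  · exact fun h => ⟨n, x, y, rfl, h⟩

/-- Alice can follow the machine on the left half of the input and Bob on the right half. -/
theorem gh_le_card_boundedCfg (f : BoolFamily) (M : TM) (n K : ℕ)
    (hdec : ∀ w, ∃ t, M.DecidesWithin f.language w t)
    (hK : ∀ w : List Bool, w.length = n + n → (M.visited w).encard ≤ K) :
    gh (f n) ≤ 4 * Nat.card (M.boundedCfg (n + n) K) := by
  classical
  have := TM.finite_boundedCfg (M := M) (n + n) K
  have := Fintype.ofFinite (M.boundedCfg (n + n) K)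
  rw [Nat.card_eq_fintype_card]
  -- A dummy for the half that a player does not know; only its length matters, as a player moves
  -- only when the head reads the left end marker or `x` (Alice), or `y` or the right end marker
  -- (Bob).
  let o : List Bool := List.replicate n false
  let word : (Fin n → Bool) → (Fin n → Bool) → List Bool := fun x y => List.ofFn x ++ List.ofFn y
  have hlen : ∀ x y, (word x y).length = n + n := by simp [word]
  have hmem : ∀ x y t, M.run (word x y) t ∈ M.boundedCfg (n + n) K := fun x y t =>
    hlen x y ▸ TM.run_mem_boundedCfg (hK _ (hlen x y)) t
  let run : (Fin n → Bool) → (Fin n → Bool) → ℕ → M.boundedCfg (n + n) K :=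
    fun x y t => ⟨M.run (word x y) t, hmem x y t⟩
  -- The membership test makes the step total: bounded configurations that do not occur in the run
  -- might step out of bounds.
  let stepA : (Fin n → Bool) → M.boundedCfg (n + n) K → M.boundedCfg (n + n) K := fun x c =>
    if h : c.1.inPos ≤ n ∧ M.step (List.ofFn x ++ o) c ∈ M.boundedCfg (n + n) K then ⟨_, h.2⟩ else c
  let stepB : (Fin n → Bool) → M.boundedCfg (n + n) K → M.boundedCfg (n + n) K := fun y c =>
    if h : ¬ c.1.inPos ≤ n ∧ M.step (o ++ List.ofFn y) c ∈ M.boundedCfg (n + n) K then ⟨_, h.2⟩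
    else c
  have hstep : ∀ x y t,
      (stepA x (run x y t) = run x y (t + 1) ∧ stepB y (run x y t) = run x y t) ∨
      (stepA x (run x y t) = run x y t ∧ stepB y (run x y t) = run x y (t + 1)) := by
    intro x y t
    by_cases hpos : (run x y t).1.inPos ≤ n
    · left
      have heq : M.step (List.ofFn x ++ o) (run x y t).1 = M.run (word x y) (t + 1) := by
        rw [TM.run_succ]
        exact M.step_congr (by simp [word, o]) (TM.readInput_append_left (by simpa using hpos))
      have hm : M.step (List.ofFn x ++ o) (run x y t).1 ∈ M.boundedCfg (n + n) K :=
        heq ▸ hmem x y (t + 1)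
      constructor
      · simp only [stepA, hpos, hm, and_self, dite_true]
        exact Subtype.ext heq
      · simp [stepB, hpos]
    · right
      have heq : M.step (o ++ List.ofFn y) (run x y t).1 = M.run (word x y) (t + 1) := by
        rw [TM.run_succ]
        exact M.step_congr (by simp [word, o])
          (TM.readInput_append_right (by simp [o]) (by simpa [o] using hpos))
      have hm : M.step (o ++ List.ofFn y) (run x y t).1 ∈ M.boundedCfg (n + n) K :=
        heq ▸ hmem x y (t + 1)
      constructor
      · simp [stepA, hpos]
      · simp only [stepB, hpos, hm, not_false_eq_true, and_self, dite_true]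
        exact Subtype.ext heq
  refine gh_le_four_mul_card (f n) (run (fun _ => false) (fun _ => false) 0)
    (fun c => M.halt c.1.state) stepA stepB run (fun x y => rfl) hstep (fun x y => ?_) ?_
  · obtain ⟨t, b, hb, -⟩ := hdec (word x y)
    have hst : run x y (t + 1) = run x y t := Subtype.ext (TM.run_add_of_halt hb 1)
    refine ⟨t, b, hb, ?_⟩
    have := hstep x y t
    rw [hst] at this
    tauto
  · intro x y t b hb
    obtain ⟨t', b', hb', hiff⟩ := hdec (word x y)
    obtain rfl := TM.halt_unique hb hb'
    rw [mem_language_iff] at hiff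
    exact (Bool.eq_iff_iff.2 hiff).symm

/-- Logarithmic space yields a polynomial number of configurations. -/
theorem exists_polynomial_card_boundedCfg (M : TM) (c : ℕ) :
    ∃ p : Polynomial ℕ, ∀ n,
      4 * Nat.card (M.boundedCfg (n + n) (c * (Nat.log 2 (n + n) + 1))) ≤ p.eval n := by
  let g := Nat.card M.Γ
  open Polynomial in
  refine ⟨4 * (C (Nat.card M.State) * ((X + X + 2) *
    ((2 * (C c * (X + X + 1)) + 1) ^ M.k *
      (C g * (4 * X + 2) ^ (g * (2 * c))) ^ M.k))), fun n => ?_⟩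
  simp only [Polynomial.eval_mul, Polynomial.eval_add, Polynomial.eval_pow, Polynomial.eval_C,
    Polynomial.eval_X, Polynomial.eval_ofNat, Polynomial.eval_one]
  refine Nat.mul_le_mul_left 4 ((TM.card_boundedCfg_le _ _).trans ?_)
  -- The summand 2 is needed for `n = 0`, where the left side is 2.
  have hlog : 2 ^ (Nat.log 2 (n + n) + 1) ≤ 4 * n + 2 := by
    rcases Nat.eq_zero_or_pos n with rfl | hn
    · simp
    · have := Nat.pow_log_le_self 2 (x := n + n) (by omega)
      rw [pow_succ]
      omega
  gcongr Nat.card M.State * ((n + n + 2) * (?_ ^ M.k * ?_ ^ M.k))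
  · gcongr
    exact Nat.log_le_self 2 (n + n)
  · rw [pow_succ, Nat.mul_comm]
    refine Nat.mul_le_mul_left g ?_
    -- Replacing the base `g` by `2 ^ g` lets the exponents be swapped, so the logarithm meets the
    -- base 2.
    calc g ^ (2 * (c * (Nat.log 2 (n + n) + 1)))
        ≤ (2 ^ g) ^ (2 * (c * (Nat.log 2 (n + n) + 1))) :=
          Nat.pow_le_pow_left Nat.lt_two_pow_self.le _
      _ = (2 ^ (Nat.log 2 (n + n) + 1)) ^ (g * (2 * c)) := by
          rw [← pow_mul, ← pow_mul]
          ring_nf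
      _ ≤ (4 * n + 2) ^ (g * (2 * c)) := Nat.pow_le_pow_left hlog _

/-- Families decidable in logarithmic space have polynomial garden-hose complexity. -/
theorem not_superpolynomialGH_of_mem_classL {f : BoolFamily} (hf : f.language ∈ classL) :
    ¬ f.SuperpolynomialGH := by
  obtain ⟨M, c, h⟩ := hf
  obtain ⟨p, hp⟩ := exists_polynomial_card_boundedCfg M c
  intro hsuper
  obtain ⟨n, hn⟩ := hsuper p
  refine hn.not_ge ((gh_le_card_boundedCfg f M n _ (fun w => (h w).1) fun w hw => ?_).trans (hp n))
  exact hw ▸ (h w).2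

end GardenHose

theorem mainTheorem4
    (h : ∃ f : GardenHose.BoolFamily,
      f.language ∈ GardenHose.classP ∧ f.SuperpolynomialGH) :
    GardenHose.classP ≠ GardenHose.classL := by
  obtain ⟨f, hP, hf⟩ := h
  exact fun heq => GardenHose.not_superpolynomialGH_of_mem_classL (heq ▸ hP) hf
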